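/- Let $d\ge 0$ be an integer and let $X=(X_1,\dots,X_d)\sim\mathcal N(0,\Sigma_\rho)$ be a (possibly degenerate) centred multivariate normal vector with covariance matrix $\Sigma_\rho=(\sigma_{ij})$, so that $\sigma_{ii}$ is the variance of $X_i$. Let $f:\mathbb R\to\mathbb R$ be a function given on all of $\mathbb R$ by its (odd) Taylor series at $0$, $$f(x)=\sum_{u\ge0}\frac{f^{(2u+1)}(0)}{(2u+1)!}\,x^{2u+1}\qquad(x\in\mathbb R),$$ and for integers $k\ge0$ put $$F_k(x)=\sum_{u\ge0}\frac{f^{(2u+k)}(0)}{u!}\,x^u,\qquad G_{kij}(x)=F_k(\sigma_{ii}x)\,F_k(\sigma_{jj}x).$$ Assume that for every $i$ the power series $F_1$ converges absolutely at some point $x>\sigma_{ii}$. (This holds for every $\Sigma_\rho$ if the series $F_1$ converges on all of $\mathbb R$, in particular if the derivatives of $f$ at $0$ are bounded or grow at most geometrically.) Let $Y_i=f(X_i)$. Then: 1. for every $i$, $Y_i$ is square integrable and $\mathbb E[Y_i]=0$; 2. for all $k\ge0$ and all $i$, the series defining $F_k(\sigma_{ii}/2)$ converges absolutely; 3. for all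 $i,j$ (including $i=j$), the transformed covariance entry $\tau_{ij}=\operatorname{Cov}(Y_i,Y_j)$ is the sum of the absolutely convergent series $$\tau_{ij}=\sum_{k\ \mathrm{odd}}G_{kij}(1/2)\,\frac{\sigma_{ij}^k}{k!};$$ 4. in particular, for all $i,j$, $\sigma_{ij}=0$ implies $\tau_{ij}=0$. -/

import Mathlib

open MeasureTheory ProbabilityTheory
open scoped Nat

/-- The `u`-th term `f^{(2u+k)}(0) x^u / u!` of the power series `F_k`. -/
noncomputable def fTerm (f : ℝ → ℝ) (k : ℕ) (x : ℝ) (u : ℕ) : ℝ :=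
  iteratedDeriv (2 * u + k) f 0 / (u ! : ℝ) * x ^ u

/-- `F_k(x) = ∑_{u ≥ 0} f^{(2u+k)}(0) x^u / u!`. -/
noncomputable def fSeries (f : ℝ → ℝ) (k : ℕ) (x : ℝ) : ℝ :=
  ∑' u : ℕ, fTerm f k x u

/-- `G_{kij}(x) = F_k(σ_ii x) F_k(σ_jj x)`, where `S = (σ_ij)`. -/
noncomputable def gFun {d : ℕ} (f : ℝ → ℝ) (S : Matrix (Fin d) (Fin d) ℝ)
    (k : ℕ) (i j : Fin d) (x : ℝ) : ℝ :=
  fSeries f k (S i i * x) * fSeries f k (S j j * x)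

/-! Write e_u for f^(2u+1)(0), and s, t, c for the variances and the covariance of a pair. Each term
of the Taylor series of f(X) has L² norm at most √(2s)·|e_u|·s^u/u!
(`IsGaussianPair.integral_pow_sq_le`), and the assumption on F_1 makes these bounds summable. Hence
E[f(X)f(Y)] may be expanded termwise into mixed moments.

Only linear combinations aX + bY are used, never a density, so degenerate covariances need no
separate case. The mixed moments of odd degrees come from comparing powers of a in E[(aX + Y)^(2p)]
(`IsGaussianPair.integral_pow_mul_pow`). They are finite sums over the power c^(2l+1).

Substituting u = a + l, v = b + l and summing over a and b first factors the series into
F_k(s/2)·F_k(t/2)·c^k/k! with k = 2l + 1. The exchange is justified by `summable_triple`, which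
rests on |c| ≤ √s√t and ∑_l C(u,l)/2^u = 1. -/

/-! ### Moments of a centred real Gaussian -/

theorem hasSum_exp_mul_sq (v t : ℝ) :
    HasSum (fun n : ℕ => t ^ n * (if Even n then (v / 2) ^ (n / 2) / ((n / 2)! : ℝ) else 0))
      (Real.exp (v * t ^ 2 / 2)) := by
  have h : HasSum (fun p : ℕ => (v * t ^ 2 / 2) ^ p / (p ! : ℝ)) (Real.exp (v * t ^ 2 / 2)) := by
    rw [Real.exp_eq_exp_ℝ]
    exact NormedSpace.expSeries_div_hasSum_exp _
  have hinj : Function.Injective (fun p : ℕ => 2 * p) := fun a b hab => by simpa using hab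
  rw [← hinj.hasSum_iff]
  · convert h using 2 with p
    simp only [Function.comp_apply, even_two, Even.mul_right, if_true,
      Nat.mul_div_cancel_left p (by norm_num : 0 < 2)]
    rw [show v * t ^ 2 / 2 = t ^ 2 * (v / 2) by ring, mul_pow, ← pow_mul]
    ring
  · intro n hn
    rw [if_neg, mul_zero]
    rintro ⟨p, rfl⟩
    exact hn ⟨p, by simp; ring⟩

/-- The moment generating function has two power series at 0, one from its moments and one from
exp(vt²/2); their coefficients agree. -/
theorem integral_pow_gaussianReal (v : NNReal) (n : ℕ) :
    ∫ x, x ^ n ∂(gaussianReal 0 v) =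
      n ! * (if Even n then ((v : ℝ) / 2) ^ (n / 2) / ((n / 2)! : ℝ) else 0) := by
  have hmem : (0 : ℝ) ∈ interior (integrableExpSet id (gaussianReal 0 v)) := by
    simp [integrableExpSet_id_gaussianReal]
  have h1 := hasFPowerSeriesAt_mgf hmem
  have h2 : HasFPowerSeriesAt (mgf id (gaussianReal 0 v))
      (FormalMultilinearSeries.ofScalars ℝ
        (fun n : ℕ => if Even n then ((v : ℝ) / 2) ^ (n / 2) / ((n / 2)! : ℝ) else 0)) 0 := by
    rw [hasFPowerSeriesAt_iff]
    refine Filter.Eventually.of_forall fun z => ?_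
    simpa [mgf_id_gaussianReal, FormalMultilinearSeries.coeff_ofScalars] using
      hasSum_exp_mul_sq (v : ℝ) z
  have h3 := congrArg (fun p => p.coeff n) (h1.eq_formalMultilinearSeries h2)
  simp only [FormalMultilinearSeries.coeff_ofScalars, id, zero_mul, Real.exp_zero, mul_one] at h3
  rw [← h3, mul_div_cancel₀]
  positivity

theorem integrable_pow_gaussianReal (v : NNReal) (n : ℕ) :
    Integrable (fun x : ℝ => x ^ n) (gaussianReal 0 v) := by
  have := (memLp_id_gaussianReal (μ := 0) (v := v) (n : NNReal)).integrable_norm_pow'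
  refine (integrable_norm_iff (by fun_prop)).1 ?_
  simpa using this

/-! ### Gaussian pairs -/

/-- `X` and `Y` are jointly centred Gaussian with variances `s`, `t` and covariance `c`. -/
structure IsGaussianPair {Ω : Type*} [MeasurableSpace Ω] (P : Measure Ω) (X Y : Ω → ℝ)
    (s t c : ℝ) : Prop where
  nonneg : ∀ a b : ℝ, 0 ≤ a ^ 2 * s + 2 * a * b * c + b ^ 2 * t
  hasLaw : ∀ a b : ℝ, HasLaw (fun ω => a * X ω + b * Y ω)
    (gaussianReal 0 (a ^ 2 * s + 2 * a * b * c + b ^ 2 * t).toNNReal) P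

theorem isGaussianPair_eval {d : ℕ} {Ω : Type*} [MeasurableSpace Ω] {P : Measure Ω}
    {S : Matrix (Fin d) (Fin d) ℝ} (hS : S.PosSemidef)
    {X : Ω → EuclideanSpace ℝ (Fin d)} (hX : HasLaw X (multivariateGaussian 0 S) P) (i j : Fin d) :
    IsGaussianPair P (fun ω => X ω i) (fun ω => X ω j) (S i i) (S j j) (S i j) := by
  have hvar : ∀ a b : ℝ, Var[fun x : EuclideanSpace ℝ (Fin d) => a * x i + b * x j;
      multivariateGaussian 0 S] = a ^ 2 * S i i + 2 * a * b * S i j + b ^ 2 * S j j := by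
    intro a b
    have hm : ∀ k : Fin d, MemLp (fun x : EuclideanSpace ℝ (Fin d) => x k) 2
        (multivariateGaussian 0 S) := fun k =>
      (IsGaussian.memLp_two_id (μ := multivariateGaussian 0 S)).continuousLinearMap_comp
        (EuclideanSpace.proj (𝕜 := ℝ) k)
    rw [variance_fun_add ((hm i).const_mul a) ((hm j).const_mul b), variance_const_mul,
      variance_const_mul, covariance_const_mul_left, covariance_const_mul_right,
      covariance_eval_multivariateGaussian hS, variance_eval_multivariateGaussian hS,
      variance_eval_multivariateGaussian hS]
    ring
  refine ⟨fun a b => hvar a b ▸ variance_nonneg _ _, fun a b => ?_⟩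
  have hL : MeasurePreserving (fun x : EuclideanSpace ℝ (Fin d) => a * x i + b * x j)
      (multivariateGaussian 0 S)
      (gaussianReal 0 (a ^ 2 * S i i + 2 * a * b * S i j + b ^ 2 * S j j).toNNReal) := by
    refine ⟨by fun_prop, ?_⟩
    have he : (fun x : EuclideanSpace ℝ (Fin d) => a * x i + b * x j) =
        (a • EuclideanSpace.proj (𝕜 := ℝ) i + b • EuclideanSpace.proj (𝕜 := ℝ) j :
          EuclideanSpace ℝ (Fin d) →L[ℝ] ℝ) := by
      ext x; simp
    rw [← hvar a b, he, IsGaussian.map_eq_gaussianReal, ContinuousLinearMap.integral_comp_id_comm]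
    · simp
    exact IsGaussian.integrable_id
  exact hL.hasLaw.fun_comp hX

namespace IsGaussianPair

variable {Ω : Type*} [MeasurableSpace Ω] {P : Measure Ω} {X Y : Ω → ℝ} {s t c : ℝ}

theorem symm (h : IsGaussianPair P X Y s t c) : IsGaussianPair P Y X t s c where
  nonneg a b := by have := h.nonneg b a; linarith
  hasLaw a b := by
    have h1 : (fun ω => a * Y ω + b * X ω) = fun ω => b * X ω + a * Y ω := by ext; ring
    rw [h1, show a ^ 2 * t + 2 * a * b * c + b ^ 2 * s = b ^ 2 * s + 2 * b * a * c + a ^ 2 * t by ring]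
    exact h.hasLaw b a

theorem hasLaw_left (h : IsGaussianPair P X Y s t c) : HasLaw X (gaussianReal 0 s.toNNReal) P := by
  simpa using h.hasLaw 1 0

theorem var_nonneg (h : IsGaussianPair P X Y s t c) : 0 ≤ s := by simpa using h.nonneg 1 0

/-- Lets the product estimate for pairs yield square integrability of f(X). -/
theorem self_left (h : IsGaussianPair P X Y s t c) : IsGaussianPair P X X s s s where
  nonneg a b := by
    have := mul_nonneg (sq_nonneg (a + b)) h.var_nonneg
    linarith
  hasLaw a b := by
    have h1 : (fun ω => a * X ω + b * X ω) = fun ω => (a + b) * X ω + 0 * Y ω := by ext; ring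
    rw [h1, show a ^ 2 * s + 2 * a * b * s + b ^ 2 * s =
      (a + b) ^ 2 * s + 2 * (a + b) * 0 * c + 0 ^ 2 * t by ring]
    exact h.hasLaw (a + b) 0

theorem abs_cov_le (h : IsGaussianPair P X Y s t c) : |c| ≤ √s * √t := by
  rw [← Real.sqrt_mul h.var_nonneg]
  refine Real.abs_le_sqrt ?_
  have := discrim_le_zero (a := s) (b := 2 * c) (c := t) fun x => by
    have := h.nonneg x 1
    linarith
  unfold discrim at this
  linarith

theorem integrable_pow (h : IsGaussianPair P X Y s t c) (n : ℕ) :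
    Integrable (fun ω => X ω ^ n) P := by
  have hi := integrable_pow_gaussianReal s.toNNReal n
  rw [← h.hasLaw_left.map_eq] at hi
  exact hi.comp_aemeasurable h.hasLaw_left.aemeasurable

theorem integral_add_pow (h : IsGaussianPair P X Y s t c) (a b : ℝ) (p : ℕ) :
    ∫ ω, (a * X ω + b * Y ω) ^ (2 * p) ∂P =
      (2 * p)! * (((a ^ 2 * s + 2 * a * b * c + b ^ 2 * t) / 2) ^ p / (p ! : ℝ)) := by
  have := (h.hasLaw a b).integral_comp (f := fun x : ℝ => x ^ (2 * p)) (by fun_prop)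
  rw [integral_pow_gaussianReal, if_pos (even_two_mul p), Real.coe_toNNReal _ (h.nonneg a b),
    Nat.mul_div_cancel_left p (by norm_num : 0 < 2)] at this
  exact this

theorem integral_pow (h : IsGaussianPair P X Y s t c) (p : ℕ) :
    ∫ ω, X ω ^ (2 * p) ∂P = (2 * p)! * ((s / 2) ^ p / (p ! : ℝ)) := by
  simpa using h.integral_add_pow 1 0 p

theorem memLp_pow (h : IsGaussianPair P X Y s t c) (n : ℕ) : MemLp (fun ω => X ω ^ n) 2 P := by
  rw [memLp_two_iff_integrable_sq (h.integrable_pow n).aestronglyMeasurable]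
  simpa [← pow_mul] using h.integrable_pow (n * 2)

theorem integrable_pow_mul_pow (h : IsGaussianPair P X Y s t c) (m n : ℕ) :
    Integrable (fun ω => X ω ^ m * Y ω ^ n) P :=
  (h.memLp_pow m).integrable_mul (h.symm.memLp_pow n)

end IsGaussianPair

/-! ### Mixed moments by comparison of coefficients -/

open Polynomial in
theorem coeff_linear_pow (a b : ℝ) (n k : ℕ) :
    ((C a * X + C b) ^ n : ℝ[X]).coeff k = if k ≤ n then n.choose k * a ^ k * b ^ (n - k) else 0 := by
  have h : ((C a * X + C b) ^ n : ℝ[X]) =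
      ∑ m ∈ Finset.range (n + 1), C (a ^ m * b ^ (n - m) * n.choose m) * X ^ m := by
    rw [add_pow]
    refine Finset.sum_congr rfl fun m _ => ?_
    simp only [mul_pow, map_mul, map_pow, map_natCast]
    ring
  rw [h, finsetSum_coeff]
  simp only [coeff_C_mul_X_pow, Finset.sum_ite_eq, Finset.mem_range, Nat.lt_succ_iff]
  split_ifs <;> ring

open Polynomial in
theorem coeff_quadratic_pow (a b c : ℝ) (u v : ℕ) :
    ((C a * X ^ 2 + C c * X + C b) ^ (u + v + 1) : ℝ[X]).coeff (2 * u + 1) =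
      ∑ l ∈ Finset.range (v + 1), if l ≤ u then (u + v + 1)! *
        (a ^ (u - l) / ((u - l)! : ℝ) * (b ^ (v - l) / ((v - l)! : ℝ)) *
          (c ^ (2 * l + 1) / ((2 * l + 1)! : ℝ))) else 0 := by
  have h : ((C a * X ^ 2 + C c * X + C b) ^ (u + v + 1) : ℝ[X]) =
      ∑ i ∈ Finset.range (u + 1 + (v + 1)),
        C (b ^ (u + v + 1 - i) * (u + v + 1).choose i) * (X ^ i * (C a * X + C c) ^ i) := by
    rw [show (C a * X ^ 2 + C c * X + C b : ℝ[X]) = X * (C a * X + C c) + C b by ring, add_pow,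
      show u + v + 1 + 1 = u + 1 + (v + 1) by ring]
    refine Finset.sum_congr rfl fun m _ => ?_
    simp only [mul_pow, map_mul, map_pow, map_natCast]
    ring
  -- The i-th summand lives in degrees i to 2i, so indices i ≤ u cannot reach degree 2u + 1. The
  -- others are i = u + 1 + l, which leaves c with exponent 2l + 1.
  rw [h, finsetSum_coeff, Finset.sum_range_add]
  simp only [coeff_C_mul, coeff_X_pow_mul', coeff_linear_pow]
  rw [Finset.sum_eq_zero, zero_add]
  · refine Finset.sum_congr rfl fun l hl => ?_
    have hlv : l ≤ v := Nat.lt_succ_iff.1 (Finset.mem_range.1 hl)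
    by_cases hlu : l ≤ u
    · obtain ⟨x, rfl⟩ := Nat.exists_eq_add_of_le hlu
      obtain ⟨y, rfl⟩ := Nat.exists_eq_add_of_le hlv
      rw [if_pos (by omega), if_pos (by omega), if_pos (by omega),
        show 2 * (l + x) + 1 - (l + x + 1 + l) = x by omega,
        show l + x + 1 + l - x = 2 * l + 1 by omega,
        show l + x + (l + y) + 1 - (l + x + 1 + l) = y by omega,
        show l + x - l = x by omega, show l + y - l = y by omega,
        Nat.cast_choose ℝ (by omega : l + x + 1 + l ≤ l + x + (l + y) + 1),
        Nat.cast_choose ℝ (by omega : x ≤ l + x + 1 + l),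
        show l + x + 1 + l - x = 2 * l + 1 by omega,
        show l + x + (l + y) + 1 - (l + x + 1 + l) = y by omega]
      field_simp
    · rw [if_neg (by omega), if_neg hlu, mul_zero]
  · intro i hi
    have := Finset.mem_range.1 hi
    rw [if_pos (by omega), if_neg (by omega), mul_zero]

/-- The `l`-th contribution to the mixed moment of degrees `2u+1`, `2v+1`. -/
noncomputable def mixedTerm (s t c : ℝ) (u v l : ℕ) : ℝ :=
  if l ≤ u ∧ l ≤ v then (s / 2) ^ (u - l) / ((u - l)! : ℝ) * ((t / 2) ^ (v - l) / ((v - l)! : ℝ)) *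
          (c ^ (2 * l + 1) / ((2 * l + 1)! : ℝ)) else 0

open Polynomial in
theorem IsGaussianPair.integral_pow_mul_pow {Ω : Type*} [MeasurableSpace Ω] {P : Measure Ω}
    {X Y : Ω → ℝ} {s t c : ℝ} (h : IsGaussianPair P X Y s t c) (u v : ℕ) :
    ∫ ω, X ω ^ (2 * u + 1) * Y ω ^ (2 * v + 1) ∂P =
      (2 * u + 1)! * (2 * v + 1)! * ∑ l ∈ Finset.range (v + 1), mixedTerm s t c u v l := by
  set p := u + v + 1 with hp
  have hpoly : ∑ m ∈ Finset.range (2 * p + 1),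
        C ((2 * p).choose m * ∫ ω, X ω ^ m * Y ω ^ (2 * p - m) ∂P) * (Polynomial.X : ℝ[X]) ^ m =
      C ((2 * p)! / (p ! : ℝ)) *
        (C (s / 2) * Polynomial.X ^ 2 + C c * Polynomial.X + C (t / 2)) ^ p := by
    -- Both sides at a equal E[(aX + Y)^(2p)]: binomially expanded on the left, by the Gaussian
    -- moment formula on the right.
    refine Polynomial.funext fun a => ?_
    have h1 := h.integral_add_pow a 1 p
    simp only [add_pow, one_mul] at h1
    rw [integral_finsetSum] at h1
    · simp only [eval_finsetSum, eval_mul, eval_C, eval_pow, eval_X, eval_add]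
      have h2 : (a ^ 2 * s + 2 * a * 1 * c + 1 ^ 2 * t) / 2 = s / 2 * a ^ 2 + c * a + t / 2 := by
        ring
      rw [h2] at h1
      rw [div_mul_eq_mul_div, mul_div_assoc, ← h1]
      refine Finset.sum_congr rfl fun m _ => ?_
      rw [mul_right_comm, ← integral_const_mul]
      refine integral_congr_ae (Filter.Eventually.of_forall fun ω => ?_)
      simp only [mul_pow]
      ring
    · intro m _
      refine ((h.integrable_pow_mul_pow m (2 * p - m)).const_mul
        (a ^ m * (2 * p).choose m)).congr (Filter.Eventually.of_forall fun ω => ?_)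
      simp only [mul_pow]
      ring
  have hc := congrArg (fun q => q.coeff (2 * u + 1)) hpoly
  simp only [finsetSum_coeff, coeff_C_mul, coeff_X_pow, mul_ite, mul_one, mul_zero,
    Finset.sum_ite_eq, Finset.mem_range] at hc
  rw [if_pos (by omega), hp, coeff_quadratic_pow, Nat.cast_choose ℝ (by omega), ← hp,
    show 2 * p - (2 * u + 1) = 2 * v + 1 by omega] at hc
  have hs : (∑ l ∈ Finset.range (v + 1), if l ≤ u then (p ! : ℝ) *
        ((s / 2) ^ (u - l) / ((u - l)! : ℝ) * ((t / 2) ^ (v - l) / ((v - l)! : ℝ)) *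
          (c ^ (2 * l + 1) / ((2 * l + 1)! : ℝ))) else 0) =
      p ! * ∑ l ∈ Finset.range (v + 1), mixedTerm s t c u v l := by
    rw [Finset.mul_sum]
    refine Finset.sum_congr rfl fun l hl => ?_
    have hlv : l ≤ v := Nat.lt_succ_iff.1 (Finset.mem_range.1 hl)
    simp only [mixedTerm, hlv, and_true, mul_ite, mul_zero]
  rw [hs] at hc
  have h1 : ((2 * p)! : ℝ) ≠ 0 := by positivity
  field_simp at hc
  linarith

/-! ### L² bounds and termwise integration -/

theorem four_pow_mul_factorial_sq_le (u : ℕ) : 4 ^ u * u ! ^ 2 ≤ (2 * u + 1)! := by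
  have h1 := Nat.four_pow_le_two_mul_add_one_mul_central_binom u
  have h2 := Nat.choose_mul_factorial_mul_factorial (n := 2 * u) (k := u) (by omega)
  rw [show 2 * u - u = u by omega] at h2
  rw [Nat.factorial_succ, ← h2, sq]
  calc 4 ^ u * (u ! * u !) ≤ (2 * u + 1) * (2 * u).choose u * (u ! * u !) := by gcongr
    _ = _ := by ring

theorem two_pow_mul_factorial_le_sqrt (u : ℕ) : (2 : ℝ) ^ u * u ! ≤ √((2 * u + 1)! : ℝ) := by
  refine Real.le_sqrt_of_sq_le ?_
  have := four_pow_mul_factorial_sq_le u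
  rw [mul_pow, ← pow_mul, mul_comm u 2, pow_mul]
  norm_num
  exact_mod_cast this

theorem MeasureTheory.integrable_of_hasSum_of_summable_integral_norm {Ω ι : Type*} [Countable ι]
    [MeasurableSpace Ω] {P : Measure Ω} {G : ι → Ω → ℝ} {F : Ω → ℝ}
    (hF : AEStronglyMeasurable F P) (hG : ∀ i, Integrable (G i) P)
    (hs : Summable fun i => ∫ ω, ‖G i ω‖ ∂P) (h : ∀ ω, HasSum (fun i => G i ω) (F ω)) :
    Integrable F P := by
  refine ⟨hF, ?_⟩
  rw [hasFiniteIntegral_iff_enorm]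
  calc ∫⁻ ω, ‖F ω‖ₑ ∂P ≤ ∫⁻ ω, ∑' i, ‖G i ω‖ₑ ∂P := by
        refine lintegral_mono fun ω => ?_
        rw [← (h ω).tsum_eq]
        exact enorm_tsum_le_tsum_enorm
    _ = ∑' i, ∫⁻ ω, ‖G i ω‖ₑ ∂P := lintegral_tsum fun i => (hG i).1.enorm
    _ = ∑' i, ENNReal.ofReal (∫ ω, ‖G i ω‖ ∂P) := by
        refine tsum_congr fun i => ?_
        rw [ofReal_integral_norm_eq_lintegral_enorm (hG i)]
    _ < ⊤ := by
        rw [← ENNReal.ofReal_tsum_of_nonneg (fun i => by positivity) hs]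
        exact ENNReal.ofReal_lt_top

theorem integral_norm_mul_le_of_sq_le {Ω : Type*} [MeasurableSpace Ω] {P : Measure Ω}
    {g h : Ω → ℝ} (hg : MemLp g 2 P) (hh : MemLp h 2 P) {A B : ℝ} (hA : 0 ≤ A) (hB : 0 ≤ B)
    (hgA : ∫ ω, g ω ^ 2 ∂P ≤ A ^ 2) (hhB : ∫ ω, h ω ^ 2 ∂P ≤ B ^ 2) :
    ∫ ω, ‖g ω * h ω‖ ∂P ≤ A * B := by
  have key := integral_mul_norm_le_Lp_mul_Lq (μ := P) (f := g) (g := h) (p := 2) (q := 2)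
    (Real.HolderConjugate.two_two) (by simpa using hg) (by simpa using hh)
  simp only [norm_mul]
  refine key.trans ?_
  have e : ∀ k : Ω → ℝ, ∫ ω, ‖k ω‖ ^ (2 : ℝ) ∂P = ∫ ω, k ω ^ 2 ∂P := fun k => by
    simp
  rw [e, e, ← Real.sqrt_eq_rpow, ← Real.sqrt_eq_rpow]
  exact mul_le_mul (Real.sqrt_le_iff.2 ⟨hA, hgA⟩) (Real.sqrt_le_iff.2 ⟨hB, hhB⟩)
    (Real.sqrt_nonneg _) hA

/-- Two series of random variables that converge pointwise and absolutely in `L²` may be multiplied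
and integrated termwise. -/
theorem hasSum_integral_mul_of_summable_L2 {Ω : Type*} [MeasurableSpace Ω] {P : Measure Ω}
    {g h : ℕ → Ω → ℝ} {F H : Ω → ℝ} {A B : ℕ → ℝ}
    (hFm : AEStronglyMeasurable F P) (hHm : AEStronglyMeasurable H P)
    (hg : ∀ u, MemLp (g u) 2 P) (hh : ∀ u, MemLp (h u) 2 P)
    (hA : ∀ u, 0 ≤ A u) (hB : ∀ u, 0 ≤ B u)
    (hgA : ∀ u, ∫ ω, g u ω ^ 2 ∂P ≤ A u ^ 2) (hhB : ∀ u, ∫ ω, h u ω ^ 2 ∂P ≤ B u ^ 2)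
    (hAs : Summable A) (hBs : Summable B)
    (hF : ∀ ω, HasSum (fun u => g u ω) (F ω)) (hH : ∀ ω, HasSum (fun u => h u ω) (H ω)) :
    Integrable (fun ω => F ω * H ω) P ∧
      HasSum (fun p : ℕ × ℕ => ∫ ω, g p.1 ω * h p.2 ω ∂P) (∫ ω, F ω * H ω ∂P) := by
  have hint : ∀ p : ℕ × ℕ, Integrable (fun ω => g p.1 ω * h p.2 ω) P := fun p =>
    (hg p.1).integrable_mul (hh p.2)
  have hsum : Summable fun p : ℕ × ℕ => ∫ ω, ‖g p.1 ω * h p.2 ω‖ ∂P :=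
    Summable.of_nonneg_of_le (fun p => by positivity)
      (fun p => integral_norm_mul_le_of_sq_le (hg p.1) (hh p.2) (hA _) (hB _) (hgA _) (hhB _))
      (hAs.mul_of_nonneg hBs hA hB)
  have hpt : ∀ ω, HasSum (fun p : ℕ × ℕ => g p.1 ω * h p.2 ω) (F ω * H ω) := fun ω =>
    (hF ω).mul (hH ω) (summable_mul_of_summable_norm (hF ω).summable.norm (hH ω).summable.norm)
  refine ⟨integrable_of_hasSum_of_summable_integral_norm (hFm.mul hHm) hint hsum hpt, ?_⟩
  have := hasSum_integral_of_summable_integral_norm hint hsum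
  simpa only [fun ω => (hpt ω).tsum_eq] using this

/-- With n = 2u + 1 the moment is e²sⁿ·(2n)!/(n!³2ⁿ). The bound C(2n,n) ≤ 4ⁿ reduces the quotient to
2ⁿ/n!, and 4^u·u!² ≤ n! then gives 2/u!². -/
theorem IsGaussianPair.integral_pow_sq_le {Ω : Type*} [MeasurableSpace Ω] {P : Measure Ω}
    {X Y : Ω → ℝ} {s t c : ℝ} (h : IsGaussianPair P X Y s t c) (e : ℝ) (u : ℕ) :
    ∫ ω, (e / ((2 * u + 1)! : ℝ) * X ω ^ (2 * u + 1)) ^ 2 ∂P ≤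
      (√(2 * s) * (|e| * (s ^ u / (u ! : ℝ)))) ^ 2 := by
  have hs := h.var_nonneg
  set n := 2 * u + 1 with hn
  have h1 : ∫ ω, (e / (n ! : ℝ) * X ω ^ n) ^ 2 ∂P =
      e ^ 2 * s ^ n * ((2 * n)! / (n ! ^ 3 * 2 ^ n)) := by
    simp only [mul_pow, ← pow_mul, mul_comm n 2]
    rw [integral_const_mul, h.integral_pow n, div_pow s]
    field_simp
  have h2 : (√(2 * s) * (|e| * (s ^ u / (u ! : ℝ)))) ^ 2 = e ^ 2 * s ^ n * (2 / u ! ^ 2) := by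
    rw [mul_pow, mul_pow, Real.sq_sqrt (by positivity), sq_abs, hn]
    ring
  rw [h1, h2]
  refine mul_le_mul_of_nonneg_left ?_ (by positivity)
  rw [div_le_div_iff₀ (by positivity) (by positivity)]
  have h3 : (2 * n)! ≤ 4 ^ n * n ! ^ 2 := by
    have := Nat.choose_mul_factorial_mul_factorial (n := 2 * n) (k := n) (by omega)
    rw [show 2 * n - n = n by omega] at this
    rw [← this, mul_assoc, ← sq]
    gcongr
    rw [show (4 : ℕ) = 2 ^ 2 by norm_num, ← pow_mul]
    exact Nat.choose_le_two_pow _ _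
  have h4 := four_pow_mul_factorial_sq_le u
  rw [← hn] at h4
  have h5 : (2 * n)! * u ! ^ 2 ≤ 2 * (n ! ^ 3 * 2 ^ n) := by
    calc (2 * n)! * u ! ^ 2 ≤ 4 ^ n * n ! ^ 2 * u ! ^ 2 := by gcongr
      _ = 2 * 2 ^ n * n ! ^ 2 * (4 ^ u * u ! ^ 2) := by
        rw [show (4 : ℕ) ^ n = 2 ^ n * 2 ^ n by rw [← mul_pow]; norm_num]
        conv_lhs => rw [show (2 : ℕ) ^ n * 2 ^ n = 2 ^ n * (2 * 4 ^ u) by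
          rw [hn, pow_succ, pow_mul]; norm_num; ring]
        ring
      _ ≤ 2 * 2 ^ n * n ! ^ 2 * n ! := by gcongr
      _ = _ := by ring
  exact_mod_cast h5

/-! ### Absolute convergence and rearrangement -/

/-- Since 2^l·l! ≤ √((2l+1)!), the weight at u = a + l is at most √s·|e_u|·s^u/u! times C(u,l)/2^u,
and the binomial factors sum to 1 over l. The square roots are there because two such weights are
later multiplied. -/
theorem summable_weight {e : ℕ → ℝ} {s : ℝ} (hs : 0 ≤ s)
    (he : Summable fun u => |e u| * (s ^ u / (u ! : ℝ))) :
    Summable fun p : ℕ × ℕ => |e (p.2 + p.1)| * ((s / 2) ^ p.2 / (p.2 ! : ℝ)) *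
      (√s ^ (2 * p.1 + 1) / √((2 * p.1 + 1)! : ℝ)) := by
  have h1 : Summable fun p : ℕ × ℕ => √s * (|e p.1| * (s ^ p.1 / (p.1 ! : ℝ))) *
      (p.1.choose p.2 / 2 ^ p.1) := by
    rw [summable_prod_of_nonneg fun p => by positivity]
    have hfin : ∀ u : ℕ, HasSum (fun l : ℕ => √s * (|e u| * (s ^ u / (u ! : ℝ))) *
        ((u.choose l : ℝ) / 2 ^ u)) (√s * (|e u| * (s ^ u / (u ! : ℝ)))) := fun u => by
      have h := hasSum_sum_of_ne_finset_zero (L := .unconditional ℕ)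
        (f := fun l => ((u.choose l : ℝ) / 2 ^ u)) (s := Finset.range (u + 1)) fun l hl => by
          rw [Nat.choose_eq_zero_of_lt (by simpa [Nat.lt_succ_iff] using hl)]
          simp
      rw [← Finset.sum_div, ← Nat.cast_sum, Nat.sum_range_choose, Nat.cast_pow, Nat.cast_ofNat,
        div_self (by positivity)] at h
      simpa using h.mul_left (√s * (|e u| * (s ^ u / (u ! : ℝ))))
    refine ⟨fun u => (hfin u).summable, ?_⟩
    simp only [fun u => (hfin u).tsum_eq]
    exact he.mul_left _
  have hinj : Function.Injective fun p : ℕ × ℕ => (p.2 + p.1, p.1) := by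
    rintro ⟨l, a⟩ ⟨l', a'⟩ h
    simp only [Prod.mk.injEq] at h ⊢
    omega
  refine Summable.of_nonneg_of_le (fun p => by positivity) (fun p => ?_) (h1.comp_injective hinj)
  obtain ⟨l, a⟩ := p
  simp only [Function.comp_apply]
  calc |e (a + l)| * ((s / 2) ^ a / (a ! : ℝ)) * (√s ^ (2 * l + 1) / √((2 * l + 1)! : ℝ))
      ≤ |e (a + l)| * ((s / 2) ^ a / (a ! : ℝ)) * (√s ^ (2 * l + 1) / (2 ^ l * l !)) := by
        gcongr
        exact two_pow_mul_factorial_le_sqrt l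
    _ = _ := by
        rw [pow_succ, pow_mul, Real.sq_sqrt hs, Nat.cast_choose ℝ (Nat.le_add_left l a),
          Nat.add_sub_cancel, div_pow, pow_add, pow_add]
        field_simp

theorem summable_shift {e : ℕ → ℝ} {s : ℝ} (hs : 0 ≤ s)
    (he : Summable fun u => |e u| * (s ^ u / (u ! : ℝ))) (l : ℕ) :
    Summable fun a => e (a + l) * ((s / 2) ^ a / (a ! : ℝ)) := by
  -- For s = 0 the factor √s^(2l+1) vanishes and cannot be cancelled, but then only a = 0
  -- contributes.
  rcases hs.eq_or_lt with rfl | hpos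
  · refine summable_of_ne_finset_zero (s := {0}) fun a ha => ?_
    simp only [Finset.mem_singleton] at ha
    simp [ha]
  · have h := (summable_weight hs he).prod_factor l
    have hc : √s ^ (2 * l + 1) / √((2 * l + 1)! : ℝ) ≠ 0 := by positivity
    simp only [summable_mul_right_iff hc] at h
    refine h.of_norm_bounded fun a => le_of_eq ?_
    rw [Real.norm_eq_abs, abs_mul, abs_of_nonneg (a := (s / 2) ^ a / (a ! : ℝ)) (by positivity)]

/-- Dominated by the product of the two weight families restricted to equal l, once |c| is replaced
by √s√t. -/
theorem summable_triple {e : ℕ → ℝ} {s t c : ℝ} (hs : 0 ≤ s) (ht : 0 ≤ t)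
    (hc : |c| ≤ √s * √t)
    (hes : Summable fun u => |e u| * (s ^ u / (u ! : ℝ)))
    (het : Summable fun u => |e u| * (t ^ u / (u ! : ℝ))) :
    Summable fun p : ℕ × ℕ × ℕ => e (p.2.1 + p.1) * ((s / 2) ^ p.2.1 / (p.2.1 ! : ℝ)) *
      (e (p.2.2 + p.1) * ((t / 2) ^ p.2.2 / (p.2.2 ! : ℝ))) *
      (c ^ (2 * p.1 + 1) / ((2 * p.1 + 1)! : ℝ)) := by
  have h := (summable_weight hs hes).mul_of_nonneg (summable_weight ht het)
    (fun p => by positivity) (fun p => by positivity)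
  have hinj : Function.Injective fun p : ℕ × ℕ × ℕ => ((p.1, p.2.1), (p.1, p.2.2)) := by
    rintro ⟨l, a, b⟩ ⟨l', a', b'⟩ h
    simp only [Prod.mk.injEq] at h ⊢
    tauto
  refine (h.comp_injective hinj).of_norm_bounded fun p => ?_
  obtain ⟨l, a, b⟩ := p
  simp only [Function.comp_apply, Real.norm_eq_abs, abs_mul, abs_div, abs_pow, Nat.abs_cast]
  rw [abs_of_nonneg hs, abs_of_nonneg ht, abs_two]
  calc _ ≤ |e (a + l)| * ((s / 2) ^ a / (a ! : ℝ)) * (|e (b + l)| * ((t / 2) ^ b / (b ! : ℝ))) *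
        ((√s * √t) ^ (2 * l + 1) / ((2 * l + 1)! : ℝ)) := by gcongr
    _ = |e (a + l)| * ((s / 2) ^ a / (a ! : ℝ)) * (|e (b + l)| * ((t / 2) ^ b / (b ! : ℝ))) *
        ((√s * √t) ^ (2 * l + 1) / (√((2 * l + 1)! : ℝ) * √((2 * l + 1)! : ℝ))) := by
          rw [Real.mul_self_sqrt (by positivity)]
    _ = _ := by rw [mul_pow]; ring

/-- Rearranging the double series of mixed moments by the power of the covariance. -/
theorem hasSum_covariance_series {e : ℕ → ℝ} {s t c T : ℝ} (hs : 0 ≤ s) (ht : 0 ≤ t)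
    (hc : |c| ≤ √s * √t)
    (hes : Summable fun u => |e u| * (s ^ u / (u ! : ℝ)))
    (het : Summable fun u => |e u| * (t ^ u / (u ! : ℝ)))
    (hT : HasSum (fun p : ℕ × ℕ => e p.1 * e p.2 *
      ∑ l ∈ Finset.range (p.2 + 1), mixedTerm s t c p.1 p.2 l) T) :
    HasSum (fun l : ℕ => (∑' a, e (a + l) * ((s / 2) ^ a / (a ! : ℝ))) *
      (∑' b, e (b + l) * ((t / 2) ^ b / (b ! : ℝ))) * (c ^ (2 * l + 1) / ((2 * l + 1)! : ℝ))) T := by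
  obtain ⟨T', hT'⟩ := summable_triple hs ht hc hes het
  have hinj : Function.Injective fun p : ℕ × ℕ × ℕ => ((p.2.1 + p.1, p.2.2 + p.1), p.1) := by
    rintro ⟨l, a, b⟩ ⟨l', a', b'⟩ h
    simp only [Prod.mk.injEq] at h ⊢
    omega
  have h1 : HasSum (fun q : (ℕ × ℕ) × ℕ => e q.1.1 * e q.1.2 * mixedTerm s t c q.1.1 q.1.2 q.2)
      T' := by
    -- The image of (l, a, b) ↦ ((a + l, b + l), l) is exactly l ≤ u, l ≤ v; elsewhere `mixedTerm`
    -- is 0.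
    rw [← hinj.hasSum_iff]
    · convert hT' using 2 with p
      simp only [Function.comp_apply, mixedTerm, Nat.le_add_left, and_self, if_true,
        Nat.add_sub_cancel]
      ring
    · rintro ⟨⟨u, v⟩, l⟩ hq
      rw [mixedTerm, if_neg, mul_zero]
      rintro ⟨hu, hv⟩
      exact hq ⟨(l, u - l, v - l), by simp [Nat.sub_add_cancel hu, Nat.sub_add_cancel hv]⟩
  have h2 := h1.prod_fiberwise (g := fun p : ℕ × ℕ => e p.1 * e p.2 *
      ∑ l ∈ Finset.range (p.2 + 1), mixedTerm s t c p.1 p.2 l) fun p => by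
    rw [Finset.mul_sum]
    refine hasSum_sum_of_ne_finset_zero fun l hl => ?_
    rw [mixedTerm, if_neg, mul_zero]
    rintro ⟨-, hv⟩
    exact hl (Finset.mem_range.2 (Nat.lt_succ_iff.2 hv))
  -- Summing over l first recovers the double series of moments; below, l is summed last.
  have hTT : T' = T := h2.unique hT
  subst hTT
  refine HasSum.prod_fiberwise hT' fun l => ?_
  have hsl := summable_shift hs hes l
  have htl := summable_shift ht het l
  have h3 := hsl.hasSum.mul htl.hasSum (summable_mul_of_summable_norm hsl.norm htl.norm)
  exact h3.mul_right (c ^ (2 * l + 1) / ((2 * l + 1)! : ℝ))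

/-! ### Odd power series -/

section OddSeries

variable {f : ℝ → ℝ}

theorem odd_of_hasSum {e : ℕ → ℝ}
    (hf : ∀ x : ℝ, HasSum (fun u : ℕ => e u * x ^ (2 * u + 1)) (f x)) (x : ℝ) :
    f (-x) = -f x := by
  refine (hf (-x)).unique ?_
  have h : (fun u => e u * (-x) ^ (2 * u + 1)) = fun u => -(e u * x ^ (2 * u + 1)) :=
    funext fun u => by rw [Odd.neg_pow ⟨u, rfl⟩, mul_neg]
  rw [h]
  exact (hf x).neg

theorem measurable_of_hasSum {e : ℕ → ℝ}
    (hf : ∀ x : ℝ, HasSum (fun u : ℕ => e u * x ^ (2 * u + 1)) (f x)) : Measurable f := by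
  refine measurable_of_tendsto_metrizable
    (f := fun n x => ∑ u ∈ Finset.range n, e u * x ^ (2 * u + 1)) (fun n => by fun_prop) ?_
  exact tendsto_pi_nhds.2 fun x => (hf x).tendsto_sum_nat

theorem iteratedDeriv_even_eq_zero_of_odd (hodd : ∀ x, f (-x) = -f x) {n : ℕ} (hn : Even n) :
    iteratedDeriv n f 0 = 0 := by
  have h := iteratedDeriv_comp_neg n f (0 : ℝ)
  rw [funext hodd, iteratedDeriv_fun_neg, hn.neg_one_pow, neg_zero, one_smul] at h
  linarith

theorem summable_abs_of_summable_fTerm {s x : ℝ} (hs : 0 ≤ s) (hsx : s < x)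
    (h : Summable (fTerm f 1 x)) :
    Summable fun u => |iteratedDeriv (2 * u + 1) f 0| * (s ^ u / (u ! : ℝ)) := by
  refine Summable.of_nonneg_of_le (fun u => by positivity) (fun u => ?_) h.norm
  rw [fTerm, Real.norm_eq_abs, abs_mul, abs_div, abs_pow, Nat.abs_cast,
    abs_of_pos (hs.trans_lt hsx), div_mul_eq_mul_div, ← mul_div_assoc]
  gcongr

theorem fTerm_odd (s : ℝ) (l a : ℕ) :
    fTerm f (2 * l + 1) (s * (1 / 2)) a =
      iteratedDeriv (2 * (a + l) + 1) f 0 * ((s / 2) ^ a / (a ! : ℝ)) := by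
  rw [fTerm, show 2 * (a + l) + 1 = 2 * a + (2 * l + 1) by ring, mul_one_div]
  ring

end OddSeries

/-! ### Application to functions of Gaussian vectors -/

/-- Square integrability and the covariance series for an odd entire function of a Gaussian pair. -/
theorem IsGaussianPair.hasSum_integral_mul {Ω : Type*} [MeasurableSpace Ω] {P : Measure Ω}
    {X Y : Ω → ℝ} {s t c : ℝ} (h : IsGaussianPair P X Y s t c) {f : ℝ → ℝ} {e : ℕ → ℝ}
    (hf : ∀ x : ℝ, HasSum (fun u : ℕ => e u / ((2 * u + 1)! : ℝ) * x ^ (2 * u + 1)) (f x))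
    (hes : Summable fun u => |e u| * (s ^ u / (u ! : ℝ)))
    (het : Summable fun u => |e u| * (t ^ u / (u ! : ℝ))) :
    Integrable (fun ω => f (X ω) * f (Y ω)) P ∧
    HasSum (fun l : ℕ => (∑' a, e (a + l) * ((s / 2) ^ a / (a ! : ℝ))) *
      (∑' b, e (b + l) * ((t / 2) ^ b / (b ! : ℝ))) * (c ^ (2 * l + 1) / ((2 * l + 1)! : ℝ)))
      (∫ ω, f (X ω) * f (Y ω) ∂P) := by
  have hfm := measurable_of_hasSum hf
  have hs := h.var_nonneg
  have ht := h.symm.var_nonneg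
  have key := hasSum_integral_mul_of_summable_L2 (F := fun ω => f (X ω)) (H := fun ω => f (Y ω))
    (hfm.comp_aemeasurable h.hasLaw_left.aemeasurable).aestronglyMeasurable
    (hfm.comp_aemeasurable h.symm.hasLaw_left.aemeasurable).aestronglyMeasurable
    (fun u => (h.memLp_pow (2 * u + 1)).const_mul (e u / ((2 * u + 1)! : ℝ)))
    (fun u => (h.symm.memLp_pow (2 * u + 1)).const_mul (e u / ((2 * u + 1)! : ℝ)))
    (fun u => by positivity) (fun u => by positivity)
    (fun u => h.integral_pow_sq_le (e u) u) (fun u => h.symm.integral_pow_sq_le (e u) u)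
    (hes.mul_left _) (het.mul_left _) (fun ω => hf (X ω)) (fun ω => hf (Y ω))
  refine ⟨key.1, hasSum_covariance_series hs ht h.abs_cov_le hes het ?_⟩
  convert key.2 using 2 with p
  have hm := h.integral_pow_mul_pow p.1 p.2
  have he : ∀ ω, e p.1 / ((2 * p.1 + 1)! : ℝ) * X ω ^ (2 * p.1 + 1) *
      (e p.2 / ((2 * p.2 + 1)! : ℝ) * Y ω ^ (2 * p.2 + 1)) =
      e p.1 / ((2 * p.1 + 1)! : ℝ) * (e p.2 / ((2 * p.2 + 1)! : ℝ)) *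
        (X ω ^ (2 * p.1 + 1) * Y ω ^ (2 * p.2 + 1)) := fun ω => by ring
  simp only [he]
  rw [integral_const_mul, hm]
  field_simp

theorem IsGaussianPair.memLp_comp {Ω : Type*} [MeasurableSpace Ω] {P : Measure Ω}
    {X Y : Ω → ℝ} {s t c : ℝ} (h : IsGaussianPair P X Y s t c) {f : ℝ → ℝ} {e : ℕ → ℝ}
    (hf : ∀ x : ℝ, HasSum (fun u : ℕ => e u / ((2 * u + 1)! : ℝ) * x ^ (2 * u + 1)) (f x))
    (hes : Summable fun u => |e u| * (s ^ u / (u ! : ℝ))) : MemLp (fun ω => f (X ω)) 2 P := by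
  refine (memLp_two_iff_integrable_sq ((measurable_of_hasSum hf).comp_aemeasurable
    h.hasLaw_left.aemeasurable).aestronglyMeasurable).2 ?_
  simpa only [← sq, Function.comp_apply] using (h.self_left.hasSum_integral_mul hf hes hes).1

theorem IsGaussianPair.integral_comp_eq_zero_of_odd {Ω : Type*} [MeasurableSpace Ω] {P : Measure Ω}
    {X Y : Ω → ℝ} {s t c : ℝ} (h : IsGaussianPair P X Y s t c) {f : ℝ → ℝ} (hfm : Measurable f)
    (hodd : ∀ x, f (-x) = -f x) : ∫ ω, f (X ω) ∂P = 0 := by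
  have h1 := h.hasLaw_left.integral_comp (f := f) hfm.aestronglyMeasurable
  have h2 := h.hasLaw_left.integral_comp (f := fun x => f (-x))
    (hfm.comp measurable_neg).aestronglyMeasurable
  have h3 : ∫ x, f (-x) ∂(gaussianReal 0 s.toNNReal) = ∫ x, f x ∂(gaussianReal 0 s.toNNReal) := by
    have hmap := gaussianReal_map_neg (μ := 0) (v := s.toNNReal)
    rw [neg_zero] at hmap
    conv_rhs => rw [← hmap]
    rw [integral_map measurable_neg.aemeasurable hfm.aestronglyMeasurable]
  rw [h3] at h2
  simp only [hodd, integral_neg] at h3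
  change ∫ ω, f (X ω) ∂P = _ at h1
  linarith

theorem mainTheorem1 {d : ℕ} {Ω : Type*} [MeasurableSpace Ω] (P : Measure Ω)
    (S : Matrix (Fin d) (Fin d) ℝ) (hS : S.PosSemidef)
    (X : Ω → EuclideanSpace ℝ (Fin d)) (hX : HasLaw X (multivariateGaussian 0 S) P)
    (f : ℝ → ℝ)
    (hf : ∀ x : ℝ, HasSum
      (fun u : ℕ => iteratedDeriv (2 * u + 1) f 0 / ((2 * u + 1)! : ℝ) * x ^ (2 * u + 1)) (f x))
    (hF : ∀ i : Fin d, ∃ x : ℝ, S i i < x ∧ Summable (fTerm f 1 x)) :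
    (∀ i : Fin d, MemLp (fun ω => f (X ω i)) 2 P ∧ ∫ ω, f (X ω i) ∂P = 0) ∧
    (∀ (k : ℕ) (i : Fin d), Summable (fTerm f k (S i i * (1 / 2)))) ∧
    (∀ i j : Fin d,
      HasSum (fun k : {k : ℕ // Odd k} => gFun f S k i j (1 / 2) * (S i j ^ (k : ℕ) / ((k : ℕ)! : ℝ)))
        cov[fun ω => f (X ω i), fun ω => f (X ω j); P]) ∧
    (∀ i j : Fin d, S i j = 0 → cov[fun ω => f (X ω i), fun ω => f (X ω j); P] = 0) := by
  have : IsProbabilityMeasure P := hX.isProbabilityMeasure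
  have hpair := isGaussianPair_eval hS hX
  have hodd := odd_of_hasSum hf
  have hsum : ∀ i, Summable fun u =>
      |iteratedDeriv (2 * u + 1) f 0| * (S i i ^ u / (u ! : ℝ)) := fun i => by
    obtain ⟨x, hx, hxs⟩ := hF i
    exact summable_abs_of_summable_fTerm (hpair i i).var_nonneg hx hxs
  have hmem : ∀ i, MemLp (fun ω => f (X ω i)) 2 P := fun i => (hpair i i).memLp_comp hf (hsum i)
  have hmean : ∀ i, ∫ ω, f (X ω i) ∂P = 0 := fun i =>
    (hpair i i).integral_comp_eq_zero_of_odd (measurable_of_hasSum hf) hodd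
  have hcov : ∀ i j : Fin d, HasSum
      (fun k : {k : ℕ // Odd k} => gFun f S k i j (1 / 2) * (S i j ^ (k : ℕ) / ((k : ℕ)! : ℝ)))
        cov[fun ω => f (X ω i), fun ω => f (X ω j); P] := fun i j => by
    have h := ((hpair i j).hasSum_integral_mul hf (hsum i) (hsum j)).2
    rw [covariance_eq_sub (hmem i) (hmem j), hmean, zero_mul, sub_zero]
    have hbij : Function.Bijective fun l : ℕ => (⟨2 * l + 1, l, rfl⟩ : {k : ℕ // Odd k}) := by
      refine ⟨fun a b hab => ?_, fun ⟨k, l, hl⟩ => ⟨l, Subtype.ext hl.symm⟩⟩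
      have := congrArg Subtype.val hab
      simp only at this
      omega
    rw [← (Equiv.ofBijective _ hbij).hasSum_iff]
    change HasSum _ (∫ ω, f (X ω i) * f (X ω j) ∂P)
    convert h using 2 with l
    simp only [Function.comp_apply, Equiv.ofBijective_apply, gFun, fSeries, fTerm_odd]
  refine ⟨fun i => ⟨hmem i, hmean i⟩, fun k i => ?_, hcov, fun i j hij => ?_⟩
  · rcases Nat.even_or_odd k with hk | ⟨l, rfl⟩
    -- For even k only even-order derivatives of the odd function f occur, so every term is 0.
    · refine summable_zero.congr fun u => ?_
      rw [fTerm, iteratedDeriv_even_eq_zero_of_odd hodd ((even_two_mul u).add hk)]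
      simp
    · exact (summable_shift (hpair i i).var_nonneg (hsum i) l).congr fun a => (fTerm_odd _ _ _).symm
  · refine (hcov i j).unique ?_
    convert hasSum_zero using 2 with k
    rw [hij, zero_pow k.2.pos.ne', zero_div, mul_zero]
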